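/- Let $F$ be a connected complex manifold (Hausdorff, second countable, of finite dimension $n$), and let $G$ be a finitely generated subgroup of the group of holomorphic diffeomorphisms of $F$. Let $\Omega(G)$ be the set of points $x\in F$ whose $G$-orbit $\{g(x) : g\in G\}$ is finite. By a regular volume measure on $F$ we mean a regular Borel measure on $F$ (in particular, finite on compact sets) which in every chart of the holomorphic atlas of $F$ is given by a measurable density, with values in $(0,\infty)$, with respect to Lebesgue measure on $\mathbb{C}^n$; for instance, the measure defined by a smooth or continuous positive volume form. If $\mu(\Omega(G))>0$ for some regular volume measure $\mu$ on $F$, then $G$ is a finite group. -/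

import Mathlib

open scoped Manifold ContDiff ENNReal
open MeasureTheory

/-- Complex affine space `ℂⁿ`. -/
abbrev CSpace (n : ℕ) : Type := Fin n → ℂ

/-- The holomorphic (that is, complex analytic) diffeomorphisms of a complex manifold `F` of
dimension `n` onto itself. -/
abbrev HolDiffeo (n : ℕ) (F : Type*) [TopologicalSpace F] [ChartedSpace (CSpace n) F] : Type _ :=
  F ≃ₘ^ω⟮𝓘(ℂ, CSpace n), 𝓘(ℂ, CSpace n)⟯ F

/-- Holomorphic diffeomorphisms form a group under composition, `(f * g) x = f (g x)`. -/
noncomputable instance HolDiffeo.instGroup (n : ℕ) (F : Type*) [TopologicalSpace F]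
    [ChartedSpace (CSpace n) F] : Group (HolDiffeo n F) where
  mul f g := Diffeomorph.trans g f
  one := Diffeomorph.refl _ F ω
  inv f := Diffeomorph.symm f
  mul_assoc _ _ _ := Diffeomorph.ext fun _ => rfl
  one_mul _ := Diffeomorph.ext fun _ => rfl
  mul_one _ := Diffeomorph.ext fun _ => rfl
  inv_mul_cancel f := Diffeomorph.ext fun x => Diffeomorph.symm_apply_apply f x

/-- The tautological action of the holomorphic diffeomorphisms on the manifold, `f • x = f x`. -/
noncomputable instance HolDiffeo.instMulAction (n : ℕ) (F : Type*) [TopologicalSpace F]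
    [ChartedSpace (CSpace n) F] : MulAction (HolDiffeo n F) F where
  smul f x := f x
  one_smul _ := rfl
  mul_smul _ _ _ := rfl

/-- The set `Ω(G)` of points whose `G`-orbit is periodic, i.e. finite. -/
def periodicPoints {n : ℕ} {F : Type*} [TopologicalSpace F] [ChartedSpace (CSpace n) F]
    (G : Subgroup (HolDiffeo n F)) : Set F :=
  {x | (MulAction.orbit G x).Finite}

/-- A regular volume measure on a complex manifold: a regular Borel measure (in particular finite
on compact sets) which in every chart of the atlas is given by a strictly positive finite density
with respect to Lebesgue measure on `ℂⁿ`. The density is only asked to be measurable, so the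
measures defined by smooth or continuous volume forms, and Riemannian volumes, are included. -/
structure IsRegularVolumeMeasure (n : ℕ) {F : Type*} [TopologicalSpace F]
    [ChartedSpace (CSpace n) F] [MeasurableSpace F] [BorelSpace F] (μ : Measure F) : Prop where
  regular : μ.Regular
  density : ∀ e ∈ atlas (CSpace n) F, ∃ ρ : CSpace n → ℝ≥0∞, Measurable ρ ∧
    (∀ z ∈ e.target, 0 < ρ z ∧ ρ z < ⊤) ∧
    ∀ s : Set F, MeasurableSet s → s ⊆ e.source → μ s = ∫⁻ z in e '' s, ρ z

/-! A finite orbit means a stabilizer of finite index. A finitely generated group has only countably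
many such subgroups, so some finite-index `H` fixes pointwise a set of positive measure. By the
identity theorem in measure, propagated through charts by connectedness, every element of `H` is the
identity; a group whose trivial subgroup has finite index is finite. -/

section AnalyticZeroSet

variable {E : Type*} [NormedAddCommGroup E] [NormedSpace ℝ E] [MeasurableSpace E] [BorelSpace E]
  [FiniteDimensional ℝ E]

/-- A measurable set meeting every ray from the origin in a null set of parameters is null. -/
theorem addHaar_eq_zero_of_forall_volume_smul_mem (μ : Measure E) [μ.IsAddHaarMeasure]
    {Z : Set E} (hZ : MeasurableSet Z) (h : ∀ w : E, volume {t : ℝ | t • w ∈ Z} = 0) :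
    μ Z = 0 := by
  have hS : MeasurableSet {p : E × ℝ | p.2 • p.1 ∈ Z} :=
    (by fun_prop : Continuous fun p : E × ℝ => p.2 • p.1).measurable hZ
  have hprod : ∀ᵐ p ∂(μ.prod (volume : Measure ℝ)), p.2 • p.1 ∉ Z := by
    have : (μ.prod (volume : Measure ℝ)) {p : E × ℝ | p.2 • p.1 ∈ Z} = 0 :=
      Measure.measure_prod_null_of_ae_null hS (Filter.Eventually.of_forall h)
    rw [ae_iff]
    simpa using this
  -- By Fubini almost every dilate of `Z` is null; a single `t ≠ 0` suffices, as dilation rescales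
  -- Haar measure by a nonzero factor.
  have hswap : ∀ᵐ t : ℝ, ∀ᵐ w ∂μ, t • w ∉ Z :=
    (Measure.ae_ae_comm (p := fun w (t : ℝ) => t • w ∉ Z) hS.compl).1
      (Measure.ae_ae_of_ae_prod hprod)
  obtain ⟨t, ht, ht0⟩ := (hswap.and (Measure.ae_ne volume (0 : ℝ))).exists
  have hnull : μ ((fun w => t • w) ⁻¹' Z) = 0 := by
    simp only [ae_iff, not_not] at ht
    exact ht
  rw [Measure.addHaar_preimage_smul μ ht0] at hnull
  refine (mul_eq_zero.1 hnull).resolve_left ?_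
  simp [ht0]

/-- The identity theorem in measure: an analytic map on a convex open set that vanishes on a set
of positive measure vanishes identically. -/
theorem AnalyticOnNhd.eqOn_zero_of_measure_ne_zero {E' : Type*} [NormedAddCommGroup E']
    [NormedSpace ℝ E'] (μ : Measure E) [μ.IsAddHaarMeasure] {U : Set E} (hU : IsOpen U)
    (hconv : Convex ℝ U) {f : E → E'} (hf : AnalyticOnNhd ℝ f U)
    (h : μ {x ∈ U | f x = 0} ≠ 0) : Set.EqOn f 0 U := by
  intro p hp
  by_contra hfp
  refine h ?_
  have hmeas : MeasurableSet {x ∈ U | f x = 0} := by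
    have : {x ∈ U | f x = 0} = U \ (U ∩ f ⁻¹' {0}ᶜ) := by ext x; simp
    rw [this]
    exact hU.measurableSet.diff
      (hf.continuousOn.isOpen_inter_preimage hU isOpen_compl_singleton).measurableSet
  rw [← measure_preimage_add μ p]
  refine addHaar_eq_zero_of_forall_volume_smul_mem μ (measurable_const_add p hmeas) fun w => ?_
  have hγ : AnalyticOnNhd ℝ (fun t : ℝ => p + t • w) Set.univ := fun t _ => by fun_prop
  have hT : Convex ℝ ((fun t : ℝ => p + t • w) ⁻¹' U) := by
    have := (hconv.translate_preimage_right p).linear_preimage (LinearMap.toSpanSingleton ℝ E w)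
    simpa only [Set.preimage_preimage, LinearMap.toSpanSingleton_apply] using this
  have h0 : (0 : ℝ) ∈ (fun t : ℝ => p + t • w) ⁻¹' U := by simpa using hp
  have hTo : IsOpen ((fun t : ℝ => p + t • w) ⁻¹' U) := hU.preimage (by fun_prop)
  have hg : AnalyticOnNhd ℝ (fun t : ℝ => f (p + t • w)) ((fun t : ℝ => p + t • w) ⁻¹' U) :=
    fun t ht => (hf _ ht).fun_comp_of_eq (hγ t trivial) rfl
  -- On the line through `p`, `f` is nonzero at `t = 0` and the parameter set is an interval by
  -- convexity, so the zeros are isolated, hence null.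
  have hcod := hg.preimage_zero_mem_codiscreteWithin (x := 0) (by simpa using hfp) h0
    ⟨⟨0, h0⟩, hT.isPreconnected⟩
  have hae := ae_restrict_le_codiscreteWithin (μ := (volume : Measure ℝ)) hTo.measurableSet hcod
  rw [mem_ae_iff, Measure.restrict_apply' hTo.measurableSet] at hae
  refine measure_mono_null ?_ hae
  rintro t ⟨h₁, h₂⟩
  exact ⟨by simpa using h₂, h₁⟩

end AnalyticZeroSet

section FixedPoints

variable {n : ℕ} {F : Type*} [TopologicalSpace F] [ChartedSpace (CSpace n) F]

/-- A fixed point of a holomorphic diffeomorphism has a neighbourhood in its chart domain on which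
the diffeomorphism is the identity as soon as it fixes a set of positive Lebesgue measure there. -/
theorem HolDiffeo.exists_nhds_fixed_of_volume_ne_zero [IsManifold 𝓘(ℂ, CSpace n) ω F]
    (h : HolDiffeo n F) {x : F} (hx : h x = x) :
    ∃ V : Set F, IsOpen V ∧ x ∈ V ∧ V ⊆ (chartAt (CSpace n) x).source ∧
      (volume (chartAt (CSpace n) x '' {y ∈ V | h y = y}) ≠ 0 → ∀ y ∈ V, h y = y) := by
  set e := chartAt (CSpace n) x with he
  have hxe : x ∈ e.source := mem_chart_source _ x
  have hmax : e ∈ IsManifold.maximalAtlas 𝓘(ℂ, CSpace n) ω F :=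
    IsManifold.chart_mem_maximalAtlas x
  have hW : IsOpen (e.source ∩ h ⁻¹' e.source) :=
    e.open_source.inter (e.open_source.preimage h.continuous)
  have hxW : x ∈ e.source ∩ h ⁻¹' e.source := ⟨hxe, by simpa [hx] using hxe⟩
  have hO : IsOpen (e.target ∩ e.symm ⁻¹' (e.source ∩ h ⁻¹' e.source)) :=
    e.isOpen_inter_preimage_symm hW
  obtain ⟨r, hr, hball⟩ := Metric.isOpen_iff.1 hO (e x)
    ⟨e.map_source hxe, by simpa [e.left_inv hxe] using hxW⟩
  have hC : ContMDiffOn 𝓘(ℂ, CSpace n) 𝓘(ℂ, CSpace n) ω (e ∘ h ∘ e.symm)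
      (Metric.ball (e x) r) := by
    refine (contMDiffOn_of_mem_maximalAtlas hmax).comp
      (h.contMDiff.comp_contMDiffOn
        ((contMDiffOn_symm_of_mem_maximalAtlas hmax).mono fun z hz => (hball hz).1)) ?_
    exact fun z hz => (hball hz).2.2
  have hA : AnalyticOnNhd ℂ (e ∘ h ∘ e.symm) (Metric.ball (e x) r) := by
    rw [← Metric.isOpen_ball.analyticOn_iff_analyticOnNhd,
      ← contDiffOn_omega_iff_analyticOn Metric.isOpen_ball.uniqueDiffOn]
    exact contMDiffOn_iff_contDiffOn.1 hC
  have hA' : AnalyticOnNhd ℝ (fun z => (e ∘ h ∘ e.symm) z - z) (Metric.ball (e x) r) :=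
    (hA.sub analyticOnNhd_id).restrictScalars
  refine ⟨e.source ∩ e ⁻¹' Metric.ball (e x) r, e.isOpen_inter_preimage Metric.isOpen_ball,
    ⟨hxe, Metric.mem_ball_self hr⟩, Set.inter_subset_left, fun hvol y hy => ?_⟩
  have hzero := hA'.eqOn_zero_of_measure_ne_zero volume Metric.isOpen_ball (convex_ball _ _)
    fun h0 => hvol <| measure_mono_null (by
      rintro _ ⟨y, ⟨⟨hys, hyb⟩, hfix⟩, rfl⟩
      exact ⟨hyb, by simp [e.left_inv hys, hfix]⟩) h0
  have hey : e (h y) = e y := by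
    have := hzero hy.2
    simpa [e.left_inv hy.1, sub_eq_zero] using this
  -- Injectivity of the chart needs `h y ∈ e.source`; the ball was chosen inside `h ⁻¹' e.source`
  -- for this.
  refine e.injOn ?_ hy.1 hey
  have := (hball hy.2).2.2
  simpa [e.left_inv hy.1] using this

/-- A holomorphic diffeomorphism of a connected complex manifold that fixes a set of positive
volume is the identity. -/
theorem HolDiffeo.eq_one_of_measure_fixedPoints_ne_zero [T2Space F] [SecondCountableTopology F]
    [ConnectedSpace F] [IsManifold 𝓘(ℂ, CSpace n) ω F] [MeasurableSpace F] [BorelSpace F]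
    {μ : Measure F} (hμ : IsRegularVolumeMeasure n μ) (h : HolDiffeo n F)
    (hpos : μ {x | h x = x} ≠ 0) : h = 1 := by
  have hclosed : IsClosed {x | h x = x} := isClosed_eq h.continuous continuous_id
  have hne : (interior {x | h x = x}).Nonempty := by
    by_contra hempty
    -- Second countability reduces nullity to a local statement.
    refine hpos (measure_null_of_locally_null _ fun x hx => ?_)
    obtain ⟨V, hVo, hxV, hVs, hV⟩ := h.exists_nhds_fixed_of_volume_ne_zero hx
    refine ⟨{y ∈ V | h y = y},
      Filter.inter_mem (mem_nhdsWithin_of_mem_nhds (hVo.mem_nhds hxV)) self_mem_nhdsWithin, ?_⟩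
    obtain ⟨ρ, -, -, hρ⟩ := hμ.density _ (chart_mem_atlas (CSpace n) x)
    have hnull : volume (chartAt (CSpace n) x '' {y ∈ V | h y = y}) = 0 := by
      by_contra hvol
      exact hempty ⟨x, interior_maximal (fun y hy => hV hvol y hy) hVo hxV⟩
    refine (hρ _ (hVo.measurableSet.inter hclosed.measurableSet) fun y hy => hVs hy.1).trans ?_
    exact setLIntegral_measure_zero _ _ hnull
  have hclopen : IsClopen (interior {x | h x = x}) := by
    refine ⟨isClosed_of_closure_subset fun x hx => ?_, isOpen_interior⟩
    have hfix : h x = x := hclosed.closure_subset_iff.2 interior_subset hx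
    obtain ⟨V, hVo, hxV, hVs, hV⟩ := h.exists_nhds_fixed_of_volume_ne_zero hfix
    -- `V` meets the interior in a nonempty open set, whose chart image has positive volume.
    refine interior_maximal (fun y hy => hV ?_ y hy) hVo hxV
    have hopen : IsOpen (chartAt (CSpace n) x '' (V ∩ interior {x | h x = x})) :=
      (chartAt (CSpace n) x).isOpen_image_of_subset_source (hVo.inter isOpen_interior)
        fun y hy => hVs hy.1
    have hnon : (V ∩ interior {x | h x = x}).Nonempty := mem_closure_iff.1 hx V hVo hxV
    intro hvol
    refine (hopen.measure_pos volume (hnon.image _)).ne' (measure_mono_null ?_ hvol)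
    exact Set.image_mono fun y hy => ⟨hy.1, interior_subset (s := {x | h x = x}) hy.2⟩
  refine Diffeomorph.ext fun x => ?_
  have hx : x ∈ interior {x | h x = x} := hclopen.eq_univ hne ▸ Set.mem_univ x
  exact interior_subset (s := {x | h x = x}) hx

end FixedPoints

/-- A finitely generated group has only countably many subgroups of finite index. -/
theorem Subgroup.countable_setOf_finiteIndex (G : Type*) [Group G] [Group.FG G] :
    {H : Subgroup G | H.FiniteIndex}.Countable := by
  have : Countable G := by
    obtain ⟨S, _, f, hf⟩ :=
      Group.fg_iff_exists_freeGroup_hom_surjective_finite.1 ‹Group.FG G›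
    exact hf.countable
  refine (Set.countable_range fun S : Finset G => Subgroup.closure (S : Set G)).mono ?_
  -- By Schreier's lemma `H` is finitely generated, and a countable group has countably many finite
  -- subsets.
  intro H hH
  have : H.FiniteIndex := hH
  obtain ⟨S, hS⟩ := (Group.fg_iff_subgroup_fg H).1 (Subgroup.fg_of_index_ne_zero H)
  exact ⟨S, hS⟩

theorem theorem3 (n : ℕ) (F : Type*) [TopologicalSpace F] [T2Space F]
    [SecondCountableTopology F] [ConnectedSpace F] [ChartedSpace (CSpace n) F]
    [IsManifold 𝓘(ℂ, CSpace n) ω F] [MeasurableSpace F] [BorelSpace F]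
    (G : Subgroup (HolDiffeo n F)) (hG : G.FG)
    (hμ : ∃ μ : Measure F, IsRegularVolumeMeasure n μ ∧ 0 < μ (periodicPoints G)) :
    Finite G := by
  obtain ⟨μ, hμ, hpos⟩ := hμ
  have : Group.FG G := (Group.fg_iff_subgroup_fg G).2 hG
  obtain ⟨H, hH, hHpos⟩ : ∃ H : Subgroup G, H.FiniteIndex ∧
      μ {x | ∀ g ∈ H, (g : HolDiffeo n F) x = x} ≠ 0 := by
    by_contra! hall
    refine hpos.ne' (measure_mono_null (t := ⋃ H ∈ {H : Subgroup G | H.FiniteIndex},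
      {x | ∀ g ∈ H, (g : HolDiffeo n F) x = x}) ?_
      ((measure_biUnion_null_iff (Subgroup.countable_setOf_finiteIndex G)).2 hall))
    intro x hx
    have : Finite (MulAction.orbit G x) := hx
    have : Finite (G ⧸ MulAction.stabilizer G x) :=
      Finite.of_equiv _ (MulAction.orbitEquivQuotientStabilizer G x)
    exact Set.mem_biUnion (x := MulAction.stabilizer G x)
      (Subgroup.finiteIndex_of_finite_quotient) fun g hg => MulAction.mem_stabilizer_iff.1 hg
  have hbot : H = ⊥ := by
    refine (Subgroup.eq_bot_iff_forall H).2 fun g hg => Subtype.ext ?_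
    refine HolDiffeo.eq_one_of_measure_fixedPoints_ne_zero hμ _ fun h0 => hHpos ?_
    exact measure_mono_null (fun x hx => hx g hg) h0
  subst hbot
  -- `Nat.card` is `0` on infinite types, so a nonzero index of `⊥` gives finiteness.
  refine Nat.finite_of_card_ne_zero ?_
  rw [← Subgroup.index_bot]
  exact hH.index_ne_zero
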